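/- Let $L>0$, $b\in\mathbb{R}\setminus\{0\}$, $0<\alpha_1\le\alpha_2$, $f\in L^2(0,L)$, and let $A^\varepsilon$ be a measurable function on $(0,L)$ with $\alpha_1\le A^\varepsilon(x)\le\alpha_2$ for almost every $x\in(0,L)$. For an interval $K$ and $w,v\in H^1(K)$ put $a_K(w,v)=\int_K \big(A^\varepsilon w'v'+b\,w'v\big)$. Let $u^\varepsilon\in H^1_0(0,L)$ be the weak solution of $$-(A^\varepsilon (u^\varepsilon)')'+b\,(u^\varepsilon)'=f\ \text{ in }(0,L),\qquad u^\varepsilon(0)=u^\varepsilon(L)=0,$$ that is, $a_{(0,L)}(u^\varepsilon,v)=\int_0^L fv$ for all $v\in H^1_0(0,L)$. Let $0=x_0<x_1<\dots<x_N=L$ be a mesh whose elements $K_k=(x_k,x_{k+1})$ all have length at most $H$, and for $0<i<N$ let $\phi^0_i$ be the continuous piecewise affine hat function of the node $x_i$. Let the Adv-MsFEM basis function $\phi^\varepsilon_i$ be the function that solves, on every element $K$ of the mesh, the local advection-diffusion problem $$-(A^\varepsilon(\phi^\varepsilon_i)')'+b\,(\phi^\varepsilon_i)'=0\ \text{ in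 }K,\qquad \phi^\varepsilon_i=\phi^0_i\ \text{ on }\partial K,$$ in the weak sense: $\phi^\varepsilon_i\in H^1(K)$ and $a_K(\phi^\varepsilon_i,v)=0$ for all $v\in H^1_0(K)$. Let $V=\mathrm{Span}\{\phi^\varepsilon_i:\ 0<i<N\}$ and let $u^\varepsilon_H\in V$ be the Adv-MsFEM (Galerkin) approximation: $a_{(0,L)}(u^\varepsilon_H,v)=\int_0^L fv$ for all $v\in V$. Then $u^\varepsilon_H\in H^1_0(0,L)$ and $$|u^\varepsilon-u^\varepsilon_H|_{H^1(0,L)}\le H\left(\sqrt{\frac{\alpha_2}{\alpha_1}}+\frac{|b|H}{\alpha_1}\right)\frac{\|f\|_{L^2(0,L)}}{\alpha_1},$$ where $|v|_{H^1(0,L)}=\|v'\|_{L^2(0,L)}$. -/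

import Mathlib

open MeasureTheory
open scoped ContDiff

noncomputable section

namespace AdvMsFEM

/-- `g` is a weak derivative of `u` on the open interval `(s, t)`: integration by parts holds
against every smooth test function whose compact support lies in `(s, t)`. -/
def HasWeakDeriv (s t : ℝ) (u g : ℝ → ℝ) : Prop :=
  ∀ φ : ℝ → ℝ, ContDiff ℝ ∞ φ → HasCompactSupport φ → tsupport φ ⊆ Set.Ioo s t →
    ∫ y in Set.Ioo s t, u y * deriv φ y = -∫ y in Set.Ioo s t, g y * φ y

/-- `u` belongs to the Sobolev space `H¹(s, t)`. As usual in dimension one, an element of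
`H¹(s, t)` is identified with its representative that is continuous on `[s, t]`. The values of
`u` outside `[s, t]` are irrelevant. -/
def MemH1 (s t : ℝ) (u : ℝ → ℝ) : Prop :=
  ContinuousOn u (Set.Icc s t) ∧
    ∃ g : ℝ → ℝ, MemLp g 2 (volume.restrict (Set.Ioo s t)) ∧ HasWeakDeriv s t u g

/-- `u` belongs to `H¹₀(s, t)`: it is in `H¹(s, t)` and vanishes at the two end points. -/
def MemH10 (s t : ℝ) (u : ℝ → ℝ) : Prop :=
  MemH1 s t u ∧ u s = 0 ∧ u t = 0

open Classical in
/-- The weak derivative in `L²(s, t)` of a function `u` in `H¹(s, t)`; it is unique up to equality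
almost everywhere on `(s, t)`. -/
def weakDeriv (s t : ℝ) (u : ℝ → ℝ) : ℝ → ℝ :=
  if h : MemH1 s t u then Classical.choose h.2 else 0

theorem memLp_weakDeriv {s t : ℝ} {u : ℝ → ℝ} (h : MemH1 s t u) :
    MemLp (weakDeriv s t u) 2 (volume.restrict (Set.Ioo s t)) := by
  rw [weakDeriv, dif_pos h]
  exact (Classical.choose_spec h.2).1

theorem hasWeakDeriv_weakDeriv {s t : ℝ} {u : ℝ → ℝ} (h : MemH1 s t u) :
    HasWeakDeriv s t u (weakDeriv s t u) := by
  rw [weakDeriv, dif_pos h]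
  exact (Classical.choose_spec h.2).2

theorem weakDeriv_ae_eq {s t : ℝ} {u g : ℝ → ℝ} (h : MemH1 s t u)
    (hg : MemLp g 2 (volume.restrict (Set.Ioo s t))) (hug : HasWeakDeriv s t u g) :
    weakDeriv s t u =ᵐ[volume.restrict (Set.Ioo s t)] g := by
  have h1 := hasWeakDeriv_weakDeriv h
  have i1 : IntegrableOn (weakDeriv s t u) (Set.Ioo s t) :=
    (memLp_weakDeriv h).integrable one_le_two
  have i2 : IntegrableOn g (Set.Ioo s t) := hg.integrable one_le_two
  have key := IsOpen.ae_eq_zero_of_integral_contDiff_smul_eq_zero (isOpen_Ioo (a := s) (b := t))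
    (μ := volume) (f := fun y => weakDeriv s t u y - g y)
    (i1.sub i2).locallyIntegrableOn (by
      intro φ hφ hc hs
      have e1 := h1 φ hφ hc hs
      have e2 := hug φ hφ hc hs
      obtain ⟨C, hC⟩ := hc.exists_bound_of_continuous hφ.continuous
      have j1 : IntegrableOn (fun y => weakDeriv s t u y * φ y) (Set.Ioo s t) :=
        i1.mul_bdd (c := C) hφ.continuous.aestronglyMeasurable (Filter.Eventually.of_forall hC)
      have j2 : IntegrableOn (fun y => g y * φ y) (Set.Ioo s t) :=
        i2.mul_bdd (c := C) hφ.continuous.aestronglyMeasurable (Filter.Eventually.of_forall hC)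
      have e3 : ∫ y, φ y • (weakDeriv s t u y - g y)
          = ∫ y in Set.Ioo s t, φ y • (weakDeriv s t u y - g y) := by
        symm
        apply setIntegral_eq_integral_of_forall_compl_eq_zero
        intro y hy
        have : φ y = 0 := image_eq_zero_of_notMem_tsupport fun hy' => hy (hs hy')
        simp [this]
      rw [e3]
      have e4 : ∀ y, φ y • (weakDeriv s t u y - g y) = weakDeriv s t u y * φ y - g y * φ y := by
        intro y
        simp only [smul_eq_mul]
        ring
      simp only [e4]
      rw [integral_sub j1 j2]
      linarith)
  rw [Filter.EventuallyEq, ae_restrict_iff' measurableSet_Ioo]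
  filter_upwards [key] with y hy hys
  exact sub_eq_zero.mp (hy hys)

/-- The norm of `L²(s, t)`. -/
def normL2 (s t : ℝ) (g : ℝ → ℝ) : ℝ :=
  Real.sqrt (∫ y in Set.Ioo s t, g y ^ 2)

/-- The `H¹(s, t)` seminorm: the `L²(s, t)` norm of the weak derivative. -/
def seminormH1 (s t : ℝ) (u : ℝ → ℝ) : ℝ :=
  normL2 s t (weakDeriv s t u)

/-- The advection-diffusion bilinear form `∫ A u' v' + b u' v` on the interval `(s, t)`, with
diffusion coefficient `A` and constant convection field `b`. -/
def form (A : ℝ → ℝ) (b s t : ℝ) (u v : ℝ → ℝ) : ℝ :=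
  ∫ y in Set.Ioo s t,
    (A y * weakDeriv s t u y * weakDeriv s t v y + b * weakDeriv s t u y * v y)

/-- The linear form `v ↦ ∫ f v` on the interval `(s, t)`. -/
def load (f : ℝ → ℝ) (s t : ℝ) (v : ℝ → ℝ) : ℝ :=
  ∫ y in Set.Ioo s t, f y * v y

/-- `u ∈ H¹₀(0, L)` is the weak solution of `-(A u')' + b u' = f` in `(0, L)`,
`u 0 = u L = 0`. -/
def IsWeakSolution (A : ℝ → ℝ) (b L : ℝ) (f u : ℝ → ℝ) : Prop :=
  MemH10 0 L u ∧ ∀ v : ℝ → ℝ, MemH10 0 L v → form A b 0 L u v = load f 0 L v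

/-- The points `0 = x 0 < x 1 < ⋯ < x N = L` are the nodes of a mesh of `(0, L)` with elements
`(x k, x (k + 1))`, `k < N`, of length at most `H`. -/
structure IsMesh (L H : ℝ) (N : ℕ) (x : ℕ → ℝ) : Prop where
  left : x 0 = 0
  right : x N = L
  lt_succ : ∀ k < N, x k < x (k + 1)
  size : ∀ k < N, x (k + 1) - x k ≤ H

/-- The `P¹` finite element basis function (hat function) attached to the interior node `x i`. -/
def hat (x : ℕ → ℝ) (i : ℕ) (y : ℝ) : ℝ :=
  max 0 (min ((y - x (i - 1)) / (x i - x (i - 1))) ((x (i + 1) - y) / (x (i + 1) - x i)))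

/-- `ψ` is the weak solution on the element `(s, t)` of the local advection-diffusion problem
`-(A ψ')' + b ψ' = 0` in `(s, t)`, with `ψ = ψ₀` on the boundary `{s, t}`. -/
def IsLocalSolution (A : ℝ → ℝ) (b s t : ℝ) (ψ₀ ψ : ℝ → ℝ) : Prop :=
  MemH1 s t ψ ∧ (∀ v : ℝ → ℝ, MemH10 s t v → form A b s t ψ v = 0) ∧ ψ s = ψ₀ s ∧ ψ t = ψ₀ t

/-- `ψ i`, for the interior nodes `0 < i < N`, are the multiscale basis functions of the
Adv-MsFEM: on every element, `ψ i` solves the local advection-diffusion problem with the boundary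
values of the hat function of the node `x i`. -/
def IsAdvBasis (A : ℝ → ℝ) (b : ℝ) (N : ℕ) (x : ℕ → ℝ) (ψ : ℕ → ℝ → ℝ) : Prop :=
  ∀ i ∈ Set.Ioo 0 N, ∀ k < N, IsLocalSolution A b (x k) (x (k + 1)) (hat x i) (ψ i)

/-- The approximation space: the span of the basis functions of the interior nodes. -/
def advSpace (N : ℕ) (ψ : ℕ → ℝ → ℝ) : Submodule ℝ (ℝ → ℝ) :=
  Submodule.span ℝ (ψ '' Set.Ioo 0 N)

/-- `uH` is the Galerkin approximation on the finite dimensional space `V`. -/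
def IsGalerkinSolution (A : ℝ → ℝ) (b L : ℝ) (f : ℝ → ℝ) (V : Submodule ℝ (ℝ → ℝ))
    (uH : ℝ → ℝ) : Prop :=
  uH ∈ V ∧ ∀ v ∈ V, form A b 0 L uH v = load f 0 L v

end AdvMsFEM

end

noncomputable section

namespace AdvMsFEM

/-! Let `I` in the multiscale space agree with `u` at all nodes, and put `e = u - I`, `w = uH - I`,
so that `u - uH = e - w`. On each element `K`, `e` vanishes at both ends and satisfies `a_K(e, z) =
∫ f z` for every bubble `z`, because `I` solves the homogeneous local equation. Taking `z = e`
removes the convection term, since `∫ e' e = 0`. Coercivity and a Poincaré inequality with constant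
`H / √2` then give `α₁ ‖e'‖ ≤ (H / √2) ‖f‖` and `‖e‖ ≤ (H / √2) ‖e'‖`. Galerkin orthogonality gives
`a(w, w) = a(e, w)`. Since `w` solves the local equations and `e` is an admissible test function on
each element, the diffusion part of `a(e, w)` can be traded for convection, and `a(e, w) = -2b ∫ w'
e`. Hence `α₁ ‖w'‖ ≤ 2 |b| ‖e‖`, so that `‖w'‖ ≤ |b| H² ‖f‖ / α₁²`, and the triangle inequality
concludes. The key lemmas are `IsPrimitive.energy_estimate`, `IsPrimitive.form_bubble` and
`IsWeakSolution.form_element`. Weak derivatives are defined by choice, up to null sets. All calculus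
therefore runs through `IsPrimitive`, which allows any representative; `MemH1.isPrimitive` and
`IsPrimitive.memH1` pass between the two descriptions. -/

/-- On `[s, t]`, the function `u` is a primitive of the square integrable function `g`. -/
structure IsPrimitive (s t : ℝ) (u g : ℝ → ℝ) : Prop where
  memLp : MemLp g 2 (volume.restrict (Set.Ioo s t))
  eq : ∀ y ∈ Set.Icc s t, u y = u s + ∫ z in s..y, g z

/-! ### One-dimensional Sobolev functions as primitives of square integrable functions. -/

section Primitive

variable {s t r : ℝ} {u v g h : ℝ → ℝ}

theorem _root_.MeasureTheory.MemLp.intervalIntegrable_of_Ioo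
    (hg : MemLp g 2 (volume.restrict (Set.Ioo s t))) (hst : s ≤ t) :
    IntervalIntegrable g volume s t := by
  rw [intervalIntegrable_iff_integrableOn_Ioo_of_le hst]
  exact hg.integrable one_le_two

theorem setIntegral_Ioo_eq (hst : s ≤ t) (F : ℝ → ℝ) :
    ∫ y in Set.Ioo s t, F y = ∫ y in s..t, F y := by
  rw [intervalIntegral.integral_of_le hst, integral_Ioc_eq_integral_Ioo]

namespace IsPrimitive

theorem intervalIntegrable (hu : IsPrimitive s t u g) (hst : s ≤ t) :
    IntervalIntegrable g volume s t :=
  hu.memLp.intervalIntegrable_of_Ioo hst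

theorem absolutelyContinuous (hu : IsPrimitive s t u g) (hst : s ≤ t) :
    AbsolutelyContinuousOnInterval (fun y => u s + ∫ z in s..y, g z) s t := by
  have h1 := (hu.intervalIntegrable hst).absolutelyContinuousOnInterval_intervalIntegral
    (c := s) (by simp)
  have h2 : AbsolutelyContinuousOnInterval (fun _ : ℝ => u s) s t :=
    (contDiffOn_const (n := 1)).absolutelyContinuousOnInterval
  exact h2.add h1

theorem continuousOn (hu : IsPrimitive s t u g) : ContinuousOn u (Set.Icc s t) := by
  intro y hy
  have hst : s ≤ t := hy.1.trans hy.2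
  have h1 := (hu.absolutelyContinuous hst).continuousOn
  rw [Set.uIcc_of_le hst] at h1
  exact (h1.congr hu.eq) y hy

theorem memLp_self (hu : IsPrimitive s t u g) : MemLp u 2 (volume.restrict (Set.Ioo s t)) := by
  obtain ⟨C, hC⟩ := isCompact_Icc.exists_bound_of_continuousOn hu.continuousOn
  refine MemLp.of_bound
    ((hu.continuousOn.mono Set.Ioo_subset_Icc_self).aestronglyMeasurable measurableSet_Ioo) C ?_
  rw [ae_restrict_iff' measurableSet_Ioo]
  exact Filter.Eventually.of_forall fun y hy => hC y (Set.Ioo_subset_Icc_self hy)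

/-- Integration by parts for absolutely continuous functions; Lebesgue differentiation identifies
the pointwise derivatives with `g` and `h` almost everywhere. -/
theorem integral_mul_add_mul (hu : IsPrimitive s t u g) (hv : IsPrimitive s t v h) (hst : s ≤ t) :
    ∫ y in Set.Ioo s t, (g y * v y + u y * h y) = u t * v t - u s * v s := by
  rw [setIntegral_Ioo_eq hst]
  have key := (hu.absolutelyContinuous hst).integral_deriv_mul_eq_sub
    (hv.absolutelyContinuous hst)
  simp only [← hu.eq t (Set.right_mem_Icc.2 hst), ← hv.eq t (Set.right_mem_Icc.2 hst),
    intervalIntegral.integral_same, add_zero] at key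
  rw [← key]
  apply intervalIntegral.integral_congr_ae
  filter_upwards [(hu.intervalIntegrable hst).ae_hasDerivAt_integral,
    (hv.intervalIntegrable hst).ae_hasDerivAt_integral] with y h1 h2 hy
  have hy' : y ∈ Set.uIcc s t := Set.uIoc_subset_uIcc hy
  have hy2 : y ∈ Set.Icc s t := by rwa [Set.uIcc_of_le hst] at hy'
  have d1 := ((h1 hy' s Set.left_mem_uIcc).const_add (u s)).deriv
  have d2 := ((h2 hy' s Set.left_mem_uIcc).const_add (v s)).deriv
  rw [d1, d2, ← hu.eq y hy2, ← hv.eq y hy2]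

theorem of_contDiff (hu : ContDiff ℝ ∞ u) : IsPrimitive s t u (deriv u) := by
  have hd : Continuous (deriv u) := hu.continuous_deriv (by simp)
  refine ⟨?_, fun y _ => ?_⟩
  · obtain ⟨C, hC⟩ := (isCompact_Icc (a := s) (b := t)).exists_bound_of_continuousOn hd.continuousOn
    refine MemLp.of_bound hd.aestronglyMeasurable C ?_
    rw [ae_restrict_iff' measurableSet_Ioo]
    exact Filter.Eventually.of_forall fun y hy => hC y (Set.Ioo_subset_Icc_self hy)
  · rw [intervalIntegral.integral_deriv_eq_sub
      (fun x _ => (hu.differentiable (by simp)).differentiableAt) (hd.intervalIntegrable _ _)]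
    ring

theorem hasWeakDeriv (hu : IsPrimitive s t u g) : HasWeakDeriv s t u g := by
  intro φ hφ hc hs
  rcases le_or_gt t s with hts | hst
  · simp [Set.Ioo_eq_empty_of_le hts]
  have hφp : IsPrimitive s t φ (deriv φ) := of_contDiff hφ
  have key := hu.integral_mul_add_mul hφp hst.le
  have h0 : ∀ y, y ∉ Set.Ioo s t → φ y = 0 := fun y hy =>
    image_eq_zero_of_notMem_tsupport fun hy' => hy (hs hy')
  rw [h0 t (by simp), h0 s (by simp), integral_add] at key
  · linarith
  · exact hu.memLp.integrable_mul hφp.memLp_self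
  · exact hu.memLp_self.integrable_mul hφp.memLp

theorem memH1 (hu : IsPrimitive s t u g) : MemH1 s t u :=
  ⟨hu.continuousOn, g, hu.memLp, hu.hasWeakDeriv⟩

theorem weakDeriv_ae_eq (hu : IsPrimitive s t u g) :
    weakDeriv s t u =ᵐ[volume.restrict (Set.Ioo s t)] g :=
  AdvMsFEM.weakDeriv_ae_eq hu.memH1 hu.memLp hu.hasWeakDeriv

theorem add (hu : IsPrimitive s t u g) (hv : IsPrimitive s t v h) :
    IsPrimitive s t (u + v) (g + h) := by
  refine ⟨hu.memLp.add hv.memLp, fun y hy => ?_⟩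
  have hst := hy.1.trans hy.2
  have hsub : Set.uIcc s y ⊆ Set.uIcc s t := by
    rw [Set.uIcc_of_le hst, Set.uIcc_of_le hy.1]
    exact Set.Icc_subset_Icc_right hy.2
  simp only [Pi.add_apply]
  rw [intervalIntegral.integral_add ((hu.intervalIntegrable hst).mono_set hsub)
    ((hv.intervalIntegrable hst).mono_set hsub), hu.eq y hy, hv.eq y hy]
  ring

theorem smul (hu : IsPrimitive s t u g) (c : ℝ) : IsPrimitive s t (c • u) (c • g) := by
  refine ⟨hu.memLp.const_smul c, fun y hy => ?_⟩
  simp only [Pi.smul_apply, smul_eq_mul]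
  rw [intervalIntegral.integral_const_mul, hu.eq y hy]
  ring

theorem sub (hu : IsPrimitive s t u g) (hv : IsPrimitive s t v h) :
    IsPrimitive s t (u - v) (g - h) := by
  have := hu.add (hv.smul (-1))
  simpa [sub_eq_add_neg] using this

theorem zero : IsPrimitive s t 0 0 :=
  ⟨MemLp.zero, fun y _ => by simp⟩

theorem restrict (hu : IsPrimitive s t u g) {s' t' : ℝ} (hs : s ≤ s') (ht : t' ≤ t) :
    IsPrimitive s' t' u g := by
  refine ⟨hu.memLp.mono_measure (Measure.restrict_mono (Set.Ioo_subset_Ioo hs ht) le_rfl),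
    fun y hy => ?_⟩
  have hst := hs.trans (hy.1.trans (hy.2.trans ht))
  have hi := hu.intervalIntegrable hst
  have h1 : IntervalIntegrable g volume s s' := hi.mono_set (by
    rw [Set.uIcc_of_le hst, Set.uIcc_of_le hs]
    exact Set.Icc_subset_Icc_right (hy.1.trans (hy.2.trans ht)))
  have h2 : IntervalIntegrable g volume s' y := hi.mono_set (by
    rw [Set.uIcc_of_le hst, Set.uIcc_of_le hy.1]
    exact Set.Icc_subset_Icc hs (hy.2.trans ht))
  rw [hu.eq y ⟨hs.trans hy.1, hy.2.trans ht⟩, hu.eq s' ⟨hs, hy.1.trans (hy.2.trans ht)⟩,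
    ← intervalIntegral.integral_add_adjacent_intervals h1 h2]
  ring

theorem congr_ae (hu : IsPrimitive s t u g) (hgh : g =ᵐ[volume.restrict (Set.Ioo s t)] h) :
    IsPrimitive s t u h := by
  refine ⟨hu.memLp.ae_eq hgh, fun y hy => ?_⟩
  rw [hu.eq y hy, ← setIntegral_Ioo_eq hy.1, ← setIntegral_Ioo_eq hy.1]
  congr 1
  exact integral_congr_ae (ae_restrict_of_ae_restrict_of_subset (Set.Ioo_subset_Ioo_right hy.2) hgh)

/-- A single function `u` appears on both sides of `t`, so its one value there excludes a jump and
no Dirac mass enters the derivative. -/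
theorem glue (hu : IsPrimitive s t u g) (hv : IsPrimitive t r u h) (hst : s ≤ t) :
    IsPrimitive s r u (fun y => if y < t then g y else h y) := by
  set q : ℝ → ℝ := fun y => if y < t then g y else h y with hq
  have q1 : IsPrimitive s t u q := hu.congr_ae (by
    rw [Filter.EventuallyEq, ae_restrict_iff' measurableSet_Ioo]
    exact Filter.Eventually.of_forall fun y hy => by simp [hq, hy.2])
  have q2 : IsPrimitive t r u q := hv.congr_ae (by
    rw [Filter.EventuallyEq, ae_restrict_iff' measurableSet_Ioo]
    exact Filter.Eventually.of_forall fun y hy => by simp [hq, hy.1.not_gt])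
  refine ⟨?_, fun y hy => ?_⟩
  · have e1 : MemLp ((Set.Iio t).indicator g) 2 (volume.restrict (Set.Ioo s r)) := by
      rw [memLp_indicator_iff_restrict measurableSet_Iio,
        Measure.restrict_restrict measurableSet_Iio]
      exact hu.memLp.mono_measure (Measure.restrict_mono (s' := Set.Ioo s t)
        (fun y hy => ⟨hy.2.1, hy.1⟩) le_rfl)
    have e2 : MemLp ((Set.Ici t).indicator h) 2 (volume.restrict (Set.Ioo s r)) := by
      rw [memLp_indicator_iff_restrict measurableSet_Ici,
        Measure.restrict_restrict measurableSet_Ici]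
      have : volume.restrict (Set.Ico t r) = volume.restrict (Set.Ioo t r) :=
        Measure.restrict_congr_set Ioo_ae_eq_Ico.symm
      refine MemLp.mono_measure (Measure.restrict_mono (s' := Set.Ico t r)
        (fun y hy => ⟨hy.1, hy.2.2⟩) le_rfl) ?_
      rw [this]
      exact hv.memLp
    refine (e1.add e2).ae_eq (Filter.Eventually.of_forall fun y => ?_)
    rcases lt_or_ge y t with hy | hy
    · simp [hq, hy]
    · simp [hq, hy, hy.not_gt]
  · rcases le_total y t with hyt | hyt
    · exact q1.eq y ⟨hy.1, hyt⟩
    · have i2 := (q2.restrict le_rfl hy.2).intervalIntegrable hyt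
      rw [q2.eq y ⟨hyt, hy.2⟩, q1.eq t ⟨hst, le_rfl⟩,
        ← intervalIntegral.integral_add_adjacent_intervals (q1.intervalIntegrable hst) i2]
      ring

end IsPrimitive

/-- The primitive from `s` vanishes to the left of the support of `ρ`, and to the right of it
because `ρ` has zero mean; this is what makes it compactly supported. -/
theorem exists_primitive_testFunction {ρ : ℝ → ℝ} (hst : s < t) (hρ : ContDiff ℝ ∞ ρ)
    (hc : HasCompactSupport ρ) (hs : tsupport ρ ⊆ Set.Ioo s t)
    (h0 : ∫ y in Set.Ioo s t, ρ y = 0) :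
    ∃ φ : ℝ → ℝ, ContDiff ℝ ∞ φ ∧ HasCompactSupport φ ∧ tsupport φ ⊆ Set.Ioo s t ∧
      deriv φ = ρ := by
  obtain ⟨a, b, ha, hb, hab, hsub⟩ : ∃ a b, s < a ∧ b < t ∧ a ≤ b ∧ tsupport ρ ⊆ Set.Icc a b := by
    rcases (tsupport ρ).eq_empty_or_nonempty with he | hne
    · exact ⟨(s + t) / 2, (s + t) / 2, by linarith, by linarith, le_rfl, by simp [he]⟩
    · obtain ⟨a, ha⟩ := hc.isCompact.exists_isLeast hne
      obtain ⟨b, hb⟩ := hc.isCompact.exists_isGreatest hne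
      exact ⟨a, b, (hs ha.1).1, (hs hb.1).2, ha.2 hb.1, fun y hy => ⟨ha.2 hy, hb.2 hy⟩⟩
  have hz : ∀ y, y ∉ Set.Icc a b → ρ y = 0 := fun y hy =>
    image_eq_zero_of_notMem_tsupport fun hy' => hy (hsub hy')
  have hi : ∀ p q, IntervalIntegrable ρ volume p q := hρ.continuous.intervalIntegrable
  have hder : ∀ y, HasDerivAt (fun y => ∫ z in s..y, ρ z) (ρ y) y := fun y =>
    intervalIntegral.integral_hasDerivAt_right (hi _ _)
      hρ.continuous.stronglyMeasurable.stronglyMeasurableAtFilter hρ.continuous.continuousAt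
  have hd : deriv (fun y => ∫ z in s..y, ρ z) = ρ := funext fun y => (hder y).deriv
  have hout : ∀ y, y ∉ Set.Icc a b → ∫ z in s..y, ρ z = 0 := by
    intro y hy
    rw [Set.mem_Icc, not_and_or, not_le, not_le] at hy
    rcases hy with hy | hy
    · refine (intervalIntegral.integral_congr (g := fun _ => (0 : ℝ)) fun z hz' => ?_).trans
        (by simp)
      refine hz z fun hz'' => ?_
      have := (Set.mem_uIcc.1 hz')
      rcases this with h | h <;> linarith [hz''.1, h.1, h.2]
    · rw [setIntegral_Ioo_eq hst.le] at h0
      rw [← intervalIntegral.integral_add_adjacent_intervals (hi s t) (hi t y), h0, zero_add]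
      refine (intervalIntegral.integral_congr (g := fun _ => (0 : ℝ)) fun z hz' => ?_).trans
        (by simp)
      refine hz z fun hz'' => ?_
      have := (Set.mem_uIcc.1 hz')
      rcases this with h | h <;> linarith [hz''.2, h.1, h.2]
  have hts : tsupport (fun y => ∫ z in s..y, ρ z) ⊆ Set.Icc a b :=
    closure_minimal (fun y hy => by_contra fun hy' => hy (hout y hy')) isClosed_Icc
  refine ⟨fun y => ∫ z in s..y, ρ z, ?_, ?_, hts.trans (Set.Icc_subset_Ioo ha hb), hd⟩
  · rw [contDiff_infty_iff_deriv, hd]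
    exact ⟨fun y => (hder y).differentiableAt, hρ⟩
  · exact HasCompactSupport.of_support_subset_isCompact isCompact_Icc
      ((subset_tsupport _).trans hts)

/-- The lemma of du Bois-Reymond. -/
theorem exists_eq_const_of_integral_mul_deriv_eq_zero {w : ℝ → ℝ} (hst : s < t)
    (hw : ContinuousOn w (Set.Icc s t))
    (h : ∀ φ : ℝ → ℝ, ContDiff ℝ ∞ φ → HasCompactSupport φ → tsupport φ ⊆ Set.Ioo s t →
      ∫ y in Set.Ioo s t, w y * deriv φ y = 0) :
    ∃ C, ∀ y ∈ Set.Icc s t, w y = C := by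
  have iw : IntegrableOn w (Set.Ioo s t) :=
    (hw.integrableOn_Icc).mono_set Set.Ioo_subset_Icc_self
  have imul : ∀ ψ : ℝ → ℝ, ContDiff ℝ ∞ ψ → HasCompactSupport ψ →
      IntegrableOn (fun y => w y * ψ y) (Set.Ioo s t) := by
    intro ψ hψ hc
    obtain ⟨C, hC⟩ := hc.exists_bound_of_continuous hψ.continuous
    exact iw.mul_bdd (c := C) hψ.continuous.aestronglyMeasurable (Filter.Eventually.of_forall hC)
  have iio : ∀ ψ : ℝ → ℝ, tsupport ψ ⊆ Set.Ioo s t →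
      ∫ y in Set.Ioo s t, ψ y = ∫ y, ψ y := by
    intro ψ hs
    apply setIntegral_eq_integral_of_forall_compl_eq_zero
    exact fun y hy => image_eq_zero_of_notMem_tsupport fun hy' => hy (hs hy')
  let B : ContDiffBump ((s + t) / 2) :=
    ⟨(t - s) / 8, (t - s) / 4, by linarith, by linarith⟩
  set η : ℝ → ℝ := B.normed volume with hη
  have η1 : ContDiff ℝ ∞ η := B.contDiff_normed
  have η2 : HasCompactSupport η := B.hasCompactSupport_normed
  have η3 : tsupport η ⊆ Set.Ioo s t := by
    rw [hη, B.tsupport_normed_eq, Real.closedBall_eq_Icc]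
    exact Set.Icc_subset_Ioo (by simp only [B]; linarith) (by simp only [B]; linarith)
  have η4 : ∫ y in Set.Ioo s t, η y = 1 := by
    rw [iio η η3]
    exact B.integral_normed
  set C := ∫ y in Set.Ioo s t, w y * η y with hC
  have key := IsOpen.ae_eq_zero_of_integral_contDiff_smul_eq_zero (isOpen_Ioo (a := s) (b := t))
    (μ := volume) (f := fun y => w y - C)
    (iw.sub (integrableOn_const (by simp))).locallyIntegrableOn (by
      intro ψ hψ hc hs
      have i1 := imul ψ hψ hc
      have iψ : Integrable ψ := hψ.continuous.integrable_of_hasCompactSupport hc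
      have iη : Integrable η := η1.continuous.integrable_of_hasCompactSupport η2
      set c := ∫ y in Set.Ioo s t, ψ y with hcdef
      -- Subtracting the multiple `c` of the unit-mass bump makes the mean zero, so `ρ` is the
      -- derivative of a test function. The hypothesis then reads `∫ w ψ = c C`, that is `∫ (w - C)
      -- ψ = 0`.
      set ρ : ℝ → ℝ := fun y => ψ y - c * η y with hρ
      have ρs : tsupport ρ ⊆ Set.Ioo s t := by
        refine (closure_minimal (t := tsupport ψ ∪ tsupport η) (fun y hy => ?_)
          ((isClosed_tsupport _).union (isClosed_tsupport _))).trans (Set.union_subset hs η3)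
        by_contra hn
        rw [Set.mem_union, not_or] at hn
        apply hy
        simp [hρ, image_eq_zero_of_notMem_tsupport hn.1, image_eq_zero_of_notMem_tsupport hn.2]
      have ρc : HasCompactSupport ρ := hc.sub (η2.mul_left)
      have ρ0 : ∫ y in Set.Ioo s t, ρ y = 0 := by
        rw [hρ, integral_sub iψ.integrableOn (iη.integrableOn.const_mul c), integral_const_mul, η4]
        simp [hcdef]
      obtain ⟨φ, p1, p2, p3, p4⟩ := exists_primitive_testFunction hst
        (hψ.sub (contDiff_const.mul η1)) ρc ρs ρ0
      have e := h φ p1 p2 p3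
      rw [p4] at e
      have e' : ∀ y, w y * (ψ y - c * η y) = w y * ψ y - c * (w y * η y) := fun y => by ring
      simp only [e'] at e
      rw [integral_sub i1 ((imul η η1 η2).const_mul c), integral_const_mul, ← hC] at e
      have e3 : ∫ y, ψ y • (w y - C) = ∫ y in Set.Ioo s t, ψ y • (w y - C) := by
        symm
        apply setIntegral_eq_integral_of_forall_compl_eq_zero
        intro y hy
        have : ψ y = 0 := image_eq_zero_of_notMem_tsupport fun hy' => hy (hs hy')
        simp [this]
      rw [e3]
      have e4 : ∀ y, ψ y • (w y - C) = w y * ψ y - C * ψ y := fun y => by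
        simp only [smul_eq_mul]; ring
      simp only [e4]
      rw [integral_sub i1 (iψ.integrableOn.const_mul C), integral_const_mul, ← hcdef]
      linarith)
  refine ⟨C, Measure.eqOn_Icc_of_ae_eq volume hst.ne ?_ hw continuousOn_const⟩
  rw [← restrict_Ioo_eq_restrict_Icc, Filter.EventuallyEq, ae_restrict_iff' measurableSet_Ioo]
  filter_upwards [key] with y hy hys
  exact sub_eq_zero.mp (hy hys)

/-- The difference between `u` and the primitive of its weak derivative is continuous with zero weak
derivative, hence constant by du Bois-Reymond. -/
theorem MemH1.isPrimitive (hu : MemH1 s t u) : IsPrimitive s t u (weakDeriv s t u) := by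
  refine ⟨memLp_weakDeriv hu, ?_⟩
  rcases le_or_gt t s with hts | hst
  · intro y hy
    have : y = s := le_antisymm (hy.2.trans hts) hy.1
    simp [this]
  set g := weakDeriv s t u with hg
  have hG : IsPrimitive s t (fun y => ∫ z in s..y, g z) g :=
    ⟨memLp_weakDeriv hu, fun y _ => by simp⟩
  obtain ⟨C, hC⟩ := exists_eq_const_of_integral_mul_deriv_eq_zero hst
    (w := fun y => u y - ∫ z in s..y, g z) (hu.1.sub hG.continuousOn) (by
      intro φ hφ hc hs
      have e1 := hasWeakDeriv_weakDeriv hu φ hφ hc hs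
      have e2 := hG.hasWeakDeriv φ hφ hc hs
      have hφp : IsPrimitive s t φ (deriv φ) := IsPrimitive.of_contDiff hφ
      have iu : MemLp u 2 (volume.restrict (Set.Ioo s t)) := by
        obtain ⟨C, hC⟩ := isCompact_Icc.exists_bound_of_continuousOn hu.1
        refine MemLp.of_bound ((hu.1.mono Set.Ioo_subset_Icc_self).aestronglyMeasurable
          measurableSet_Ioo) C ?_
        rw [ae_restrict_iff' measurableSet_Ioo]
        exact Filter.Eventually.of_forall fun y hy => hC y (Set.Ioo_subset_Icc_self hy)
      simp only [sub_mul]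
      refine (integral_sub (iu.integrable_mul hφp.memLp)
        (hG.memLp_self.integrable_mul hφp.memLp)).trans ?_
      simp only [Pi.mul_apply]
      rw [e1, e2]
      ring)
  intro y hy
  have h1 := hC y hy
  have h2 := hC s ⟨le_rfl, hst.le⟩
  simp only [intervalIntegral.integral_same] at h2
  linarith

end Primitive

/-! ### Cauchy–Schwarz, Poincaré, coercivity and energy estimates on one interval. -/

section Estimates

/-- Cauchy–Schwarz: the quadratic polynomial `c ↦ ∫ (c p + q)²` is nonnegative, so its discriminant
is nonpositive. -/
theorem sq_integral_mul_le {μ : Measure ℝ} {p q : ℝ → ℝ} (hp : MemLp p 2 μ) (hq : MemLp q 2 μ) :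
    (∫ y, p y * q y ∂μ) ^ 2 ≤ (∫ y, p y ^ 2 ∂μ) * ∫ y, q y ^ 2 ∂μ := by
  have key : ∀ c : ℝ, 0 ≤ (∫ y, p y ^ 2 ∂μ) * (c * c) + (2 * ∫ y, p y * q y ∂μ) * c
      + ∫ y, q y ^ 2 ∂μ := by
    intro c
    have h : 0 ≤ ∫ y, (c * p y + q y) ^ 2 ∂μ := integral_nonneg fun y => sq_nonneg _
    have e : ∀ y, (c * p y + q y) ^ 2 = (c * c) * p y ^ 2 + (2 * c) * (p y * q y) + q y ^ 2 :=
      fun y => by ring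
    simp only [e] at h
    have i1 : Integrable (fun y => (c * c) * p y ^ 2) μ := hp.integrable_sq.const_mul _
    have i2 : Integrable (fun y => (2 * c) * (p y * q y)) μ := (hp.integrable_mul hq).const_mul _
    have i3 : Integrable (fun y => (c * c) * p y ^ 2 + (2 * c) * (p y * q y)) μ := i1.add i2
    rw [integral_add i3 hq.integrable_sq, integral_add i1 i2, integral_const_mul,
      integral_const_mul] at h
    linarith
  have := discrim_le_zero key
  rw [discrim] at this
  linarith

theorem sqrt_integral_sub_sq_le {μ : Measure ℝ} {p q : ℝ → ℝ} (hp : MemLp p 2 μ)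
    (hq : MemLp q 2 μ) :
    √(∫ y, (p y - q y) ^ 2 ∂μ) ≤ √(∫ y, p y ^ 2 ∂μ) + √(∫ y, q y ^ 2 ∂μ) := by
  have e : ∀ y, (p y - q y) ^ 2 = p y ^ 2 - 2 * (p y * q y) + q y ^ 2 := fun y => by ring
  simp only [e]
  have i2 : Integrable (fun y => 2 * (p y * q y)) μ := (hp.integrable_mul hq).const_mul _
  have i3 : Integrable (fun y => p y ^ 2 - 2 * (p y * q y)) μ := hp.integrable_sq.sub i2
  rw [integral_add i3 hq.integrable_sq, integral_sub hp.integrable_sq i2,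
    integral_const_mul]
  have hP : 0 ≤ ∫ y, p y ^ 2 ∂μ := integral_nonneg fun y => sq_nonneg _
  have hQ : 0 ≤ ∫ y, q y ^ 2 ∂μ := integral_nonneg fun y => sq_nonneg _
  have h := Real.abs_le_sqrt (sq_integral_mul_le hp hq)
  rw [Real.sqrt_mul hP] at h
  refine Real.sqrt_le_iff.2 ⟨by positivity, ?_⟩
  rw [add_sq, Real.sq_sqrt hP, Real.sq_sqrt hQ]
  linarith [neg_abs_le (∫ y, p y * q y ∂μ)]

variable {s t : ℝ} {u v g h A : ℝ → ℝ}

/-- A Poincaré inequality for functions that vanish at the left end point. -/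
theorem IsPrimitive.integral_sq_le (hu : IsPrimitive s t u g) (hst : s ≤ t) (h0 : u s = 0) :
    ∫ y in Set.Ioo s t, u y ^ 2 ≤ (t - s) ^ 2 / 2 * ∫ y in Set.Ioo s t, g y ^ 2 := by
  set X := ∫ y in Set.Ioo s t, g y ^ 2 with hX
  -- Cauchy–Schwarz against the constant `1` on `(s, y)`. Integrating the weight `y - s` afterwards
  -- produces the factor `1/2`, on which the final constant depends.
  have hpt : ∀ y ∈ Set.Ioo s t, u y ^ 2 ≤ (y - s) * X := by
    intro y hy
    have hsub : Set.Ioo s y ⊆ Set.Ioo s t := Set.Ioo_subset_Ioo_right hy.2.le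
    have hg : MemLp g 2 (volume.restrict (Set.Ioo s y)) :=
      hu.memLp.mono_measure (Measure.restrict_mono hsub le_rfl)
    have cs := sq_integral_mul_le (memLp_const (1 : ℝ)) hg
    simp only [one_mul, one_pow, integral_const, smul_eq_mul, mul_one] at cs
    rw [measureReal_restrict_apply_univ, Real.volume_real_Ioo_of_le hy.1.le] at cs
    rw [hu.eq y ⟨hy.1.le, hy.2.le⟩, h0, zero_add, ← setIntegral_Ioo_eq hy.1.le]
    refine cs.trans (mul_le_mul_of_nonneg_left ?_ (by linarith [hy.1]))
    exact setIntegral_mono_set hu.memLp.integrable_sq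
      (Filter.Eventually.of_forall fun z => sq_nonneg _) hsub.eventuallyLE
  calc ∫ y in Set.Ioo s t, u y ^ 2 ≤ ∫ y in Set.Ioo s t, (y - s) * X := by
        refine setIntegral_mono_on hu.memLp_self.integrable_sq ?_ measurableSet_Ioo hpt
        have hc : Continuous fun y : ℝ => (y - s) * X := by fun_prop
        exact (hc.integrableOn_Icc).mono_set Set.Ioo_subset_Icc_self
    _ = (t - s) ^ 2 / 2 * X := by
        rw [setIntegral_Ioo_eq hst, intervalIntegral.integral_mul_const,
          intervalIntegral.integral_sub (by simp) (by simp)]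
        simp only [integral_id, intervalIntegral.integral_const, smul_eq_mul]
        ring

theorem integrable_coeff_mul {μ : Measure ℝ} {α₁ α₂ : ℝ} (hAm : AEStronglyMeasurable A μ)
    (hA : ∀ᵐ y ∂μ, α₁ ≤ A y ∧ A y ≤ α₂) (hg : MemLp g 2 μ) (hh : MemLp h 2 μ) :
    Integrable (fun y => A y * g y * h y) μ := by
  have h1 : Integrable (fun y => A y * (g y * h y)) μ :=
    (hg.integrable_mul hh).bdd_mul (c := |α₁| + |α₂|) hAm (by
      filter_upwards [hA] with y hy
      rw [Real.norm_eq_abs, abs_le]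
      constructor
      · linarith [neg_abs_le α₁, abs_nonneg α₂, hy.1]
      · linarith [le_abs_self α₂, abs_nonneg α₁, hy.2])
  simpa only [mul_assoc] using h1

/-- The integrand is half the derivative of `u²`. This is why constant convection contributes
nothing to the energy, whatever the size of `b`. -/
theorem IsPrimitive.integral_self_mul (hu : IsPrimitive s t u g) (hst : s ≤ t) (h0 : u s = 0)
    (h1 : u t = 0) : ∫ y in Set.Ioo s t, g y * u y = 0 := by
  have key := hu.integral_mul_add_mul hu hst
  have e : ∀ y, g y * u y + u y * g y = 2 * (g y * u y) := fun y => by ring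
  simp only [e, h0, h1] at key
  rw [integral_const_mul] at key
  linarith

variable {α₁ α₂ b : ℝ}

theorem integrable_form (hAm : AEStronglyMeasurable A (volume.restrict (Set.Ioo s t)))
    (hA : ∀ᵐ y ∂(volume.restrict (Set.Ioo s t)), α₁ ≤ A y ∧ A y ≤ α₂)
    (hg : MemLp g 2 (volume.restrict (Set.Ioo s t)))
    (hv : IsPrimitive s t v h) :
    IntegrableOn (fun y => A y * g y * h y + b * g y * v y) (Set.Ioo s t) := by
  have h2 : Integrable (fun y => b * (g y * v y)) (volume.restrict (Set.Ioo s t)) :=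
    (hg.integrable_mul hv.memLp_self).const_mul b
  simp only [← mul_assoc] at h2
  exact (integrable_coeff_mul hAm hA hg hv.memLp).add h2

/-- Frees the form from the chosen weak derivatives, so that sums and restrictions can use the
natural representatives. -/
theorem form_eq_integral (hu : IsPrimitive s t u g) (hv : IsPrimitive s t v h) :
    form A b s t u v = ∫ y in Set.Ioo s t, (A y * g y * h y + b * g y * v y) := by
  refine integral_congr_ae ?_
  filter_upwards [hu.weakDeriv_ae_eq, hv.weakDeriv_ae_eq] with y h1 h2
  rw [h1, h2]

/-- Coercivity of the form on functions that vanish at both end points. -/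
theorem IsPrimitive.coercive (hAm : AEStronglyMeasurable A (volume.restrict (Set.Ioo s t)))
    (hA : ∀ᵐ y ∂(volume.restrict (Set.Ioo s t)), α₁ ≤ A y ∧ A y ≤ α₂)
    (hu : IsPrimitive s t u g) (hst : s ≤ t) (h0 : u s = 0) (h1 : u t = 0) :
    α₁ * ∫ y in Set.Ioo s t, g y ^ 2
      ≤ ∫ y in Set.Ioo s t, (A y * g y * g y + b * g y * u y) := by
  have i1 := integrable_coeff_mul hAm hA hu.memLp hu.memLp
  have i2 : Integrable (fun y => b * (g y * u y)) (volume.restrict (Set.Ioo s t)) :=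
    (hu.memLp.integrable_mul hu.memLp_self).const_mul b
  simp only [mul_assoc b]
  rw [integral_add i1 i2, integral_const_mul, hu.integral_self_mul hst h0 h1, mul_zero, add_zero,
    ← integral_const_mul]
  refine integral_mono_ae (hu.memLp.integrable_sq.const_mul _) i1 ?_
  filter_upwards [hA] with y hy
  nlinarith [sq_nonneg (g y), hy.1]

/-- Cancels one factor of the unknown squared norm without a separate treatment of the case where it
vanishes. -/
theorem mul_le_of_sq_le_mul {X Y : ℝ} (hX : 0 ≤ X) (hY : 0 ≤ Y) (h : X ^ 2 ≤ Y * X) : X ≤ Y := by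
  rcases hX.eq_or_lt with h0 | h0
  · rwa [← h0]
  · nlinarith

/-- The energy estimate for a solution that vanishes at both end points. -/
theorem IsPrimitive.energy_estimate {f : ℝ → ℝ}
    (hAm : AEStronglyMeasurable A (volume.restrict (Set.Ioo s t)))
    (hA : ∀ᵐ y ∂(volume.restrict (Set.Ioo s t)), α₁ ≤ A y ∧ A y ≤ α₂) (hα₁ : 0 < α₁)
    (hf : MemLp f 2 (volume.restrict (Set.Ioo s t)))
    (hu : IsPrimitive s t u g) (hst : s ≤ t) (h0 : u s = 0) (h1 : u t = 0)
    (heq : ∫ y in Set.Ioo s t, (A y * g y * g y + b * g y * u y)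
      = ∫ y in Set.Ioo s t, f y * u y) :
    α₁ ^ 2 * ∫ y in Set.Ioo s t, g y ^ 2
      ≤ (t - s) ^ 2 / 2 * ∫ y in Set.Ioo s t, f y ^ 2 := by
  have c := hu.coercive (b := b) hAm hA hst h0 h1
  rw [heq] at c
  have p := hu.integral_sq_le hst h0
  have cs := sq_integral_mul_le hf hu.memLp_self
  set X := ∫ y in Set.Ioo s t, g y ^ 2
  set F := ∫ y in Set.Ioo s t, f y ^ 2
  set Y := ∫ y in Set.Ioo s t, u y ^ 2
  have hX : 0 ≤ X := integral_nonneg fun y => sq_nonneg _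
  have hF : 0 ≤ F := integral_nonneg fun y => sq_nonneg _
  have h2 : (α₁ * X) ^ 2 ≤ F * ((t - s) ^ 2 / 2 * X) :=
    (pow_le_pow_left₀ (by positivity) c 2).trans
      (cs.trans (mul_le_mul_of_nonneg_left p hF))
  refine mul_le_of_sq_le_mul (by positivity) (by positivity) ?_
  calc (α₁ ^ 2 * X) ^ 2 = α₁ ^ 2 * (α₁ * X) ^ 2 := by ring
    _ ≤ α₁ ^ 2 * (F * ((t - s) ^ 2 / 2 * X)) := by gcongr
    _ = _ := by ring

/-- The form of a bubble function `u` against a local solution `v`. -/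
theorem IsPrimitive.form_bubble (hAm : AEStronglyMeasurable A (volume.restrict (Set.Ioo s t)))
    (hA : ∀ᵐ y ∂(volume.restrict (Set.Ioo s t)), α₁ ≤ A y ∧ A y ≤ α₂)
    (hu : IsPrimitive s t u g) (hv : IsPrimitive s t v h) (hst : s ≤ t)
    (h0 : u s = 0) (h1 : u t = 0)
    (heq : ∫ y in Set.Ioo s t, (A y * h y * g y + b * h y * u y) = 0) :
    ∫ y in Set.Ioo s t, (A y * g y * h y + b * g y * v y)
      = -(2 * b) * ∫ y in Set.Ioo s t, h y * u y := by
  have i1 := integrable_coeff_mul hAm hA hv.memLp hu.memLp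
  have i2 : Integrable (fun y => h y * u y) (volume.restrict (Set.Ioo s t)) :=
    hv.memLp.integrable_mul hu.memLp_self
  have i3 : Integrable (fun y => g y * v y) (volume.restrict (Set.Ioo s t)) :=
    hu.memLp.integrable_mul hv.memLp_self
  have p := hu.integral_mul_add_mul hv hst
  have e : ∀ y, g y * v y + u y * h y = g y * v y + h y * u y := fun y => by ring
  simp only [e] at p
  rw [integral_add i3 i2, h0, h1] at p
  simp only [mul_assoc b] at heq
  rw [integral_add i1 (i2.const_mul b), integral_const_mul] at heq
  have e' : ∀ y, A y * g y * h y + b * g y * v y = A y * h y * g y + b * (g y * v y) :=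
    fun y => by ring
  simp only [e']
  rw [integral_add i1 (i3.const_mul b), integral_const_mul]
  -- One `-b ∫ h u` comes from replacing the diffusion term by means of the local equation, the
  -- other from moving the derivative in `∫ g v`; they add up to `-2b`.
  linear_combination heq + b * p

end Estimates

/-! ### Mesh combinatorics, hat functions at nodes, and gluing over elements. -/

section Mesh

variable {L H : ℝ} {N : ℕ} {x : ℕ → ℝ}

namespace IsMesh

theorem lt_of_lt (hx : IsMesh L H N x) {i j : ℕ} (hij : i < j) (hj : j ≤ N) : x i < x j := by
  induction j, hij using Nat.le_induction with
  | base => exact hx.lt_succ i hj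
  | succ k hk ih => exact (ih (by omega)).trans (hx.lt_succ k (by omega))

theorem le_of_le (hx : IsMesh L H N x) {i j : ℕ} (hij : i ≤ j) (hj : j ≤ N) : x i ≤ x j := by
  rcases hij.eq_or_lt with h | h
  · rw [h]
  · exact (hx.lt_of_lt h hj).le

theorem Ioo_subset (hx : IsMesh L H N x) {k : ℕ} (hk : k < N) :
    Set.Ioo (x k) (x (k + 1)) ⊆ Set.Ioo 0 L :=
  Set.Ioo_subset_Ioo (hx.left ▸ hx.le_of_le (Nat.zero_le k) hk.le) (hx.right ▸ hx.le_of_le hk le_rfl)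

theorem sum_integral (hx : IsMesh L H N x) {F : ℝ → ℝ} (hF : IntegrableOn F (Set.Ioo 0 L)) :
    ∑ k ∈ Finset.range N, ∫ y in Set.Ioo (x k) (x (k + 1)), F y = ∫ y in Set.Ioo 0 L, F y := by
  have h0L : 0 ≤ L := by
    have := hx.le_of_le (Nat.zero_le N) le_rfl
    rwa [hx.left, hx.right] at this
  rw [setIntegral_Ioo_eq h0L, ← hx.left, ← hx.right,
    ← intervalIntegral.sum_integral_adjacent_intervals]
  · refine Finset.sum_congr rfl fun k hk => setIntegral_Ioo_eq ?_ F
    exact (hx.lt_succ k (Finset.mem_range.1 hk)).le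
  · intro k hk
    rw [intervalIntegrable_iff_integrableOn_Ioo_of_le (hx.lt_succ k hk).le]
    exact hF.mono_set (hx.Ioo_subset hk)

theorem hat_apply (hx : IsMesh L H N x) {i j : ℕ} (hi : i ∈ Set.Ioo 0 N) (hj : j ≤ N) :
    hat x i (x j) = if i = j then 1 else 0 := by
  -- Writing `i = m + 1` removes the truncated subtraction `i - 1` in `hat`.
  obtain ⟨m, rfl⟩ : ∃ m, i = m + 1 := ⟨i - 1, by have := hi.1; omega⟩
  have h1 : 0 < x (m + 1) - x m := sub_pos.2 (hx.lt_succ m (by have := hi.2; omega))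
  have h2 : 0 < x (m + 2) - x (m + 1) := sub_pos.2 (hx.lt_succ (m + 1) hi.2)
  simp only [hat, Nat.add_sub_cancel]
  split_ifs with hij
  · subst hij
    rw [div_self h1.ne', div_self h2.ne']
    simp
  · apply max_eq_left
    rcases Nat.lt_or_gt_of_ne hij with h | h
    · refine (min_le_right _ _).trans (div_nonpos_of_nonpos_of_nonneg ?_ h2.le)
      linarith [hx.le_of_le (show m + 1 + 1 ≤ j from h) hj]
    · refine (min_le_left _ _).trans (div_nonpos_of_nonpos_of_nonneg ?_ h1.le)
      linarith [hx.le_of_le (show j ≤ m by omega) (by have := hi.2; omega)]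

/-- The multiscale basis functions are given as `H¹` only element by element; repeated gluing makes
them globally `H¹`, hence conforming. -/
theorem exists_isPrimitive (hx : IsMesh L H N x) {u : ℝ → ℝ}
    (hu : ∀ k < N, MemH1 (x k) (x (k + 1)) u) : ∃ g, IsPrimitive 0 L u g := by
  have key : ∀ n ≤ N, ∃ g, IsPrimitive (x 0) (x n) u g := by
    intro n
    induction n with
    | zero =>
      intro _
      refine ⟨0, by simp, fun y hy => ?_⟩
      rw [le_antisymm hy.2 hy.1]
      simp
    | succ k ih =>
      intro hk
      obtain ⟨g, hg⟩ := ih (by omega)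
      exact ⟨_, hg.glue (hu k hk).isPrimitive (hx.le_of_le (Nat.zero_le k) (by omega))⟩
  have := key N le_rfl
  rwa [hx.left, hx.right] at this

end IsMesh

end Mesh

/-! ### The multiscale space: conformity, local equations and nodal interpolation. -/

section Space

variable {L H b α₁ α₂ : ℝ} {N : ℕ} {x : ℕ → ℝ} {A : ℝ → ℝ} {ψ : ℕ → ℝ → ℝ}

/-- `v` belongs to `H¹₀(0, L)` and solves the homogeneous equation on every element. -/
def IsElementwiseSolution (A : ℝ → ℝ) (b L : ℝ) (N : ℕ) (x : ℕ → ℝ) (v : ℝ → ℝ) : Prop :=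
  MemH10 0 L v ∧ ∀ k < N, ∀ z, MemH10 (x k) (x (k + 1)) z → form A b (x k) (x (k + 1)) v z = 0

theorem MemH10.add {s t : ℝ} {u v : ℝ → ℝ} (hu : MemH10 s t u) (hv : MemH10 s t v) :
    MemH10 s t (u + v) :=
  ⟨(hu.1.isPrimitive.add hv.1.isPrimitive).memH1, by simp [hu.2.1, hv.2.1],
    by simp [hu.2.2, hv.2.2]⟩

theorem MemH10.smul {s t : ℝ} {u : ℝ → ℝ} (hu : MemH10 s t u) (c : ℝ) : MemH10 s t (c • u) :=
  ⟨(hu.1.isPrimitive.smul c).memH1, by simp [hu.2.1], by simp [hu.2.2]⟩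

theorem MemH1.restrict_element (hx : IsMesh L H N x) {u : ℝ → ℝ} (hu : MemH1 0 L u) {k : ℕ}
    (hk : k < N) : IsPrimitive (x k) (x (k + 1)) u (weakDeriv 0 L u) :=
  hu.isPrimitive.restrict (hx.left ▸ hx.le_of_le (Nat.zero_le k) hk.le)
    (hx.right ▸ hx.le_of_le hk le_rfl)

theorem IsAdvBasis.apply_node (hx : IsMesh L H N x) (hψ : IsAdvBasis A b N x ψ) {i j : ℕ}
    (hi : i ∈ Set.Ioo 0 N) (hj : j ≤ N) : ψ i (x j) = if i = j then 1 else 0 := by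
  rw [← hx.hat_apply hi hj]
  rcases hj.eq_or_lt with h | h
  · obtain ⟨m, rfl⟩ : ∃ m, N = m + 1 := ⟨N - 1, by have := hi.1.trans hi.2; omega⟩
    rw [h]
    exact (hψ i hi m (Nat.lt_succ_self m)).2.2.2
  · exact (hψ i hi j h).2.2.1

theorem IsAdvBasis.isElementwiseSolution_basis (hx : IsMesh L H N x) (hψ : IsAdvBasis A b N x ψ)
    {i : ℕ} (hi : i ∈ Set.Ioo 0 N) : IsElementwiseSolution A b L N x (ψ i) := by
  obtain ⟨g, hg⟩ := hx.exists_isPrimitive fun k hk => (hψ i hi k hk).1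
  refine ⟨⟨hg.memH1, ?_, ?_⟩, fun k hk => (hψ i hi k hk).2.1⟩
  · simpa [hx.left, hi.1.ne'] using hψ.apply_node hx hi (Nat.zero_le N)
  · simpa [hx.right, hi.2.ne] using hψ.apply_node hx hi le_rfl

/-- The local equations are linear in the solution. The bounds on `A` supply the integrability
needed to split the integral of a sum. -/
theorem IsAdvBasis.isElementwiseSolution (hx : IsMesh L H N x) (hψ : IsAdvBasis A b N x ψ)
    (hAm : AEStronglyMeasurable A (volume.restrict (Set.Ioo 0 L)))
    (hA : ∀ᵐ y ∂(volume.restrict (Set.Ioo 0 L)), α₁ ≤ A y ∧ A y ≤ α₂)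
    {v : ℝ → ℝ} (hv : v ∈ advSpace N ψ) : IsElementwiseSolution A b L N x v := by
  have hAm' : ∀ k < N, AEStronglyMeasurable A (volume.restrict (Set.Ioo (x k) (x (k + 1)))) :=
    fun k hk => hAm.mono_measure (Measure.restrict_mono (hx.Ioo_subset hk) le_rfl)
  have hA' : ∀ k < N, ∀ᵐ y ∂(volume.restrict (Set.Ioo (x k) (x (k + 1)))),
      α₁ ≤ A y ∧ A y ≤ α₂ :=
    fun k hk => ae_restrict_of_ae_restrict_of_subset (hx.Ioo_subset hk) hA
  induction hv using Submodule.span_induction with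
  | mem v hv =>
    obtain ⟨i, hi, rfl⟩ := hv
    exact hψ.isElementwiseSolution_basis hx hi
  | zero =>
    refine ⟨⟨IsPrimitive.zero.memH1, rfl, rfl⟩, fun k hk z hz => ?_⟩
    rw [form_eq_integral IsPrimitive.zero hz.1.isPrimitive]
    simp
  | add v w _ _ hv hw =>
    refine ⟨hv.1.add hw.1, fun k hk z hz => ?_⟩
    have pv := hv.1.1.restrict_element hx hk
    have pw := hw.1.1.restrict_element hx hk
    have pz := hz.1.isPrimitive
    have e1 := hv.2 k hk z hz
    have e2 := hw.2 k hk z hz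
    rw [form_eq_integral pv pz] at e1
    rw [form_eq_integral pw pz] at e2
    rw [form_eq_integral (pv.add pw) pz]
    have e3 := integral_add (integrable_form (b := b) (hAm' k hk) (hA' k hk) pv.memLp pz)
      (integrable_form (b := b) (hAm' k hk) (hA' k hk) pw.memLp pz)
    rw [e1, e2, add_zero] at e3
    refine Eq.trans ?_ e3
    congr 1
    ext y
    simp only [Pi.add_apply]
    ring
  | smul c v _ hv =>
    refine ⟨hv.1.smul c, fun k hk z hz => ?_⟩
    have pv := hv.1.1.restrict_element hx hk
    have pz := hz.1.isPrimitive
    have e1 := hv.2 k hk z hz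
    rw [form_eq_integral pv pz] at e1
    rw [form_eq_integral (pv.smul c) pz]
    refine Eq.trans ?_ ((integral_const_mul c _).trans (by rw [e1, mul_zero]))
    congr 1
    ext y
    simp only [Pi.smul_apply, smul_eq_mul]
    ring

/-- The basis is nodal, so the coefficients are the values of `u` at interior nodes; at the two
boundary nodes both sides vanish. -/
theorem IsAdvBasis.exists_interpolant (hx : IsMesh L H N x) (hψ : IsAdvBasis A b N x ψ)
    {u : ℝ → ℝ} (h0 : u 0 = 0) (hL : u L = 0) :
    ∃ v ∈ advSpace N ψ, ∀ j ≤ N, v (x j) = u (x j) := by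
  refine ⟨∑ i ∈ Finset.Ioo 0 N, u (x i) • ψ i, Submodule.sum_mem _ fun i hi =>
    Submodule.smul_mem _ _ (Submodule.subset_span ⟨i, Finset.mem_Ioo.1 hi, rfl⟩), fun j hj => ?_⟩
  have e : ∀ i ∈ Finset.Ioo 0 N, (u (x i) • ψ i) (x j) = if i = j then u (x i) else 0 := by
    intro i hi
    rw [Pi.smul_apply, hψ.apply_node hx (Finset.mem_Ioo.1 hi) hj]
    simp
  rw [Finset.sum_apply, Finset.sum_congr rfl e, Finset.sum_ite_eq']
  split_ifs with h
  · rfl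
  · rw [Finset.mem_Ioo, not_and_or, not_lt, not_lt] at h
    rcases h with h | h
    · rw [Nat.le_zero.1 h, hx.left, h0]
    · rw [le_antisymm hj h, hx.right, hL]

end Space

/-! ### Interpolation error over the mesh, and localization of the weak equation. -/

section Error

variable {L H b α₁ α₂ : ℝ} {N : ℕ} {x : ℕ → ℝ} {A f : ℝ → ℝ}

/-- Interpolation error estimates, on an interval decomposed by a mesh. -/
theorem IsMesh.interpolation_estimate (hx : IsMesh L H N x) (hα₁ : 0 < α₁)
    (hAm : AEStronglyMeasurable A (volume.restrict (Set.Ioo 0 L)))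
    (hA : ∀ᵐ y ∂(volume.restrict (Set.Ioo 0 L)), α₁ ≤ A y ∧ A y ≤ α₂)
    (hf : MemLp f 2 (volume.restrict (Set.Ioo 0 L)))
    {e g : ℝ → ℝ} (he : IsPrimitive 0 L e g) (hnode : ∀ j ≤ N, e (x j) = 0)
    (heq : ∀ k < N, ∫ y in Set.Ioo (x k) (x (k + 1)), (A y * g y * g y + b * g y * e y)
      = ∫ y in Set.Ioo (x k) (x (k + 1)), f y * e y) :
    α₁ ^ 2 * (∫ y in Set.Ioo 0 L, g y ^ 2) ≤ H ^ 2 / 2 * (∫ y in Set.Ioo 0 L, f y ^ 2) ∧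
      (∫ y in Set.Ioo 0 L, e y ^ 2) ≤ H ^ 2 / 2 * ∫ y in Set.Ioo 0 L, g y ^ 2 := by
  have hsq : ∀ k < N, (x (k + 1) - x k) ^ 2 / 2 ≤ H ^ 2 / 2 := fun k hk => by
    have h1 := sub_pos.2 (hx.lt_succ k hk)
    have h2 := hx.size k hk
    gcongr
  have hr : ∀ k < N, IsPrimitive (x k) (x (k + 1)) e g := fun k hk =>
    he.restrict (hx.left ▸ hx.le_of_le (Nat.zero_le k) hk.le) (hx.right ▸ hx.le_of_le hk le_rfl)
  have nn : ∀ (q : ℝ → ℝ) (k : ℕ), 0 ≤ ∫ y in Set.Ioo (x k) (x (k + 1)), q y ^ 2 :=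
    fun q k => integral_nonneg fun y => sq_nonneg _
  constructor
  · rw [← hx.sum_integral he.memLp.integrable_sq, ← hx.sum_integral hf.integrable_sq,
      Finset.mul_sum, Finset.mul_sum]
    refine Finset.sum_le_sum fun k hk' => ?_
    have hk := Finset.mem_range.1 hk'
    have hμ := Measure.restrict_mono (μ := volume) (hx.Ioo_subset hk) le_rfl
    exact ((hr k hk).energy_estimate (hAm.mono_measure hμ)
      (ae_restrict_of_ae_restrict_of_subset (hx.Ioo_subset hk) hA) hα₁ (hf.mono_measure hμ)
      (hx.lt_succ k hk).le (hnode k hk.le) (hnode (k + 1) hk) (heq k hk)).trans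
      (mul_le_mul_of_nonneg_right (hsq k hk) (nn f k))
  · rw [← hx.sum_integral he.memLp.integrable_sq, ← hx.sum_integral he.memLp_self.integrable_sq,
      Finset.mul_sum]
    refine Finset.sum_le_sum fun k hk' => ?_
    have hk := Finset.mem_range.1 hk'
    exact ((hr k hk).integral_sq_le (hx.lt_succ k hk).le (hnode k hk.le)).trans
      (mul_le_mul_of_nonneg_right (hsq k hk) (nn g k))

/-- The form of a function `e` that vanishes at all nodes against an elementwise solution. -/
theorem IsMesh.form_interpolation_error (hx : IsMesh L H N x)
    (hAm : AEStronglyMeasurable A (volume.restrict (Set.Ioo 0 L)))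
    (hA : ∀ᵐ y ∂(volume.restrict (Set.Ioo 0 L)), α₁ ≤ A y ∧ A y ≤ α₂)
    {e g w : ℝ → ℝ} (he : IsPrimitive 0 L e g) (hnode : ∀ j ≤ N, e (x j) = 0)
    (hw : IsElementwiseSolution A b L N x w) :
    ∫ y in Set.Ioo 0 L, (A y * g y * weakDeriv 0 L w y + b * g y * w y)
      = -(2 * b) * ∫ y in Set.Ioo 0 L, weakDeriv 0 L w y * e y := by
  have pw := hw.1.1.isPrimitive
  rw [← hx.sum_integral (integrable_form hAm hA he.memLp pw),
    ← hx.sum_integral (F := fun y => weakDeriv 0 L w y * e y)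
      (pw.memLp.integrable_mul he.memLp_self), Finset.mul_sum]
  refine Finset.sum_congr rfl fun k hk' => ?_
  have hk := Finset.mem_range.1 hk'
  have hμ := Measure.restrict_mono (μ := volume) (hx.Ioo_subset hk) le_rfl
  have re : IsPrimitive (x k) (x (k + 1)) e g :=
    he.restrict (hx.left ▸ hx.le_of_le (Nat.zero_le k) hk.le) (hx.right ▸ hx.le_of_le hk le_rfl)
  have rw' := hw.1.1.restrict_element hx hk
  refine re.form_bubble (hAm.mono_measure hμ)
    (ae_restrict_of_ae_restrict_of_subset (hx.Ioo_subset hk) hA) rw' (hx.lt_succ k hk).le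
    (hnode k hk.le) (hnode (k + 1) hk) ?_
  rw [← form_eq_integral rw' re]
  exact hw.2 k hk e ⟨re.memH1, hnode k hk.le, hnode (k + 1) hk⟩

/-- A function that vanishes at the end points of an element, extended by zero, satisfies the weak
formulation on the whole interval; hence the weak solution satisfies the equation elementwise. -/
theorem IsWeakSolution.form_element (hx : IsMesh L H N x) {u : ℝ → ℝ}
    (hu : IsWeakSolution A b L f u) {k : ℕ} (hk : k < N) {z : ℝ → ℝ}
    (hz : MemH10 (x k) (x (k + 1)) z) :
    form A b (x k) (x (k + 1)) u z = load f (x k) (x (k + 1)) z := by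
  set s := x k with hs
  set t := x (k + 1) with ht
  have hst : s < t := hx.lt_succ k hk
  have h0s : 0 ≤ s := hx.left ▸ hx.le_of_le (Nat.zero_le k) hk.le
  have htL : t ≤ L := hx.right ▸ hx.le_of_le hk le_rfl
  have pz := hz.1.isPrimitive
  -- Nothing is known about `z` outside `[s, t]`, so it is truncated before being used as a global
  -- test function; its zero end values let the three pieces glue.
  set ζ : ℝ → ℝ := (Set.Icc s t).indicator z with hζ
  set q : ℝ → ℝ := (Set.Ioo s t).indicator (weakDeriv s t z) with hq
  have ζ1 : ∀ y ∈ Set.Icc s t, ζ y = z y := fun y hy => Set.indicator_of_mem hy z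
  have ζ0 : ∀ y, y ∉ Set.Ioo s t → ζ y = 0 := by
    intro y hy
    by_cases h : y ∈ Set.Icc s t
    · rw [ζ1 y h]
      rcases h.1.eq_or_lt with h' | h'
      · rw [← h']; exact hz.2.1
      rcases h.2.eq_or_lt with h'' | h''
      · rw [h'']; exact hz.2.2
      exact absurd ⟨h', h''⟩ hy
    · exact Set.indicator_of_notMem h z
  have hzero : ∀ p r, (∀ y ∈ Set.Icc p r, y ∉ Set.Ioo s t) → IsPrimitive p r ζ 0 := by
    refine fun p r hpr => ⟨MemLp.zero, fun y hy => ?_⟩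
    rw [ζ0 y (hpr y hy), ζ0 p (hpr p ⟨le_rfl, hy.1.trans hy.2⟩)]
    simp
  have mid : IsPrimitive s t ζ (weakDeriv s t z) := ⟨pz.memLp, fun y hy => by
    rw [ζ1 y hy, ζ1 s ⟨le_rfl, hst.le⟩, pz.eq y hy]⟩
  have glued := ((hzero 0 s fun y hy h => (hy.2.trans_lt h.1).false).glue mid h0s).glue
    (hzero t L fun y hy h => (hy.1.trans_lt h.2).false) (h0s.trans hst.le)
  have hζp : IsPrimitive 0 L ζ q := by
    refine glued.congr_ae ?_
    -- At `y = s` the glued derivative takes the value of `weakDeriv s t z` while `q` is zero; this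
    -- single point is discarded.
    have hne : ∀ᵐ y ∂(volume.restrict (Set.Ioo 0 L)), y ≠ s :=
      ae_restrict_of_ae (Measure.ae_ne volume s)
    filter_upwards [hne] with y hy
    by_cases h1 : y < t <;> by_cases h2 : y < s
    · simp [hq, h1, h2, h2.not_gt]
    · have h3 : s < y := lt_of_le_of_ne (not_lt.1 h2) (Ne.symm hy)
      simp [hq, h1, h3, h3.not_gt]
    · simp [hq, h1]
    · simp [hq, h1]
  have hζ10 : MemH10 0 L ζ := ⟨hζp.memH1, ζ0 0 fun h => (h.1.trans_le h0s).false,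
    ζ0 L fun h => (h.2.trans_le htL).false⟩
  have key := hu.2 ζ hζ10
  have pu := hu.1.1.isPrimitive
  have hsub : Set.Ioo s t ⊆ Set.Ioo 0 L := hx.Ioo_subset hk
  rw [form_eq_integral pu hζp, load,
    setIntegral_eq_of_subset_of_forall_sdiff_eq_zero measurableSet_Ioo hsub (by
      intro y hy
      simp [ζ0 y hy.2, hq, Set.indicator_of_notMem hy.2]),
    setIntegral_eq_of_subset_of_forall_sdiff_eq_zero measurableSet_Ioo hsub (by
      intro y hy
      simp [ζ0 y hy.2])] at key
  rw [form_eq_integral (pu.restrict h0s htL) pz, load]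
  refine (setIntegral_congr_fun measurableSet_Ioo fun y hy => ?_).trans
    (key.trans (setIntegral_congr_fun measurableSet_Ioo fun y hy => ?_))
  · simp only [hq, Set.indicator_of_mem hy, ζ1 y (Set.Ioo_subset_Icc_self hy)]
  · simp only [ζ1 y (Set.Ioo_subset_Icc_self hy)]

end Error

end AdvMsFEM

end

/-! ### The error estimate. -/

open AdvMsFEM Filter in
theorem mainTheorem4 (L α₁ α₂ b H : ℝ) (A f : ℝ → ℝ) (N : ℕ) (x : ℕ → ℝ) (ψ : ℕ → ℝ → ℝ)
    (u uH : ℝ → ℝ)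
    (hL : 0 < L) (hα₁ : 0 < α₁) (hb : b ≠ 0)
    (hAm : AEStronglyMeasurable A (volume.restrict (Set.Ioo 0 L)))
    (hA : ∀ᵐ y ∂(volume.restrict (Set.Ioo 0 L)), α₁ ≤ A y ∧ A y ≤ α₂)
    (hf : MemLp f 2 (volume.restrict (Set.Ioo 0 L)))
    (hx : AdvMsFEM.IsMesh L H N x)
    (hψ : AdvMsFEM.IsAdvBasis A b N x ψ)
    (hu : AdvMsFEM.IsWeakSolution A b L f u)
    (huH : AdvMsFEM.IsGalerkinSolution A b L f (AdvMsFEM.advSpace N ψ) uH) :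
    AdvMsFEM.MemH10 0 L uH ∧
      AdvMsFEM.seminormH1 0 L (u - uH) ≤
        H * (Real.sqrt (α₂ / α₁) + |b| * H / α₁) * (AdvMsFEM.normL2 0 L f / α₁) := by
  have sol : ∀ v ∈ advSpace N ψ, IsElementwiseSolution A b L N x v := fun v hv =>
    hψ.isElementwiseSolution hx hAm hA hv
  have hUH := (sol uH huH.1).1
  refine ⟨hUH, ?_⟩
  obtain ⟨I, hI, hInode⟩ := hψ.exists_interpolant hx hu.1.2.1 hu.1.2.2
  have hN : 0 < N := by
    refine Nat.pos_of_ne_zero fun h => hL.ne ?_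
    rw [← hx.left, ← hx.right, h]
  have hH : 0 < H := (sub_pos.2 (hx.lt_succ 0 hN)).trans_le (hx.size 0 hN)
  -- The interval has positive measure, so some point satisfies both coefficient bounds.
  have hα : α₁ ≤ α₂ := by
    have : NeBot (ae (volume.restrict (Set.Ioo 0 L))) := by
      rw [ae_neBot, Ne, Measure.restrict_eq_zero]
      simp [hL]
    obtain ⟨y, hy⟩ := hA.exists
    exact hy.1.trans hy.2
  have pu := hu.1.1.isPrimitive
  have pI := (sol I hI).1.1.isPrimitive
  have pUH := hUH.1.isPrimitive
  -- The interpolation error.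
  have pe := pu.sub pI
  set e := u - I with he
  set g := weakDeriv 0 L u - weakDeriv 0 L I with hg
  have enode : ∀ j ≤ N, e (x j) = 0 := fun j hj => by simp [he, hInode j hj]
  -- On each element, subtracting the local equation of `I` from that of `u`, both tested with `e`,
  -- leaves `a_K(e, e) = ∫ f e`.
  have est := hx.interpolation_estimate (b := b) hα₁ hAm hA hf pe enode (by
    intro k hk
    have hμ := Measure.restrict_mono (μ := volume) (hx.Ioo_subset hk) le_rfl
    have hs : 0 ≤ x k := hx.left ▸ hx.le_of_le (Nat.zero_le k) hk.le
    have ht : x (k + 1) ≤ L := hx.right ▸ hx.le_of_le hk le_rfl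
    have pe' := pe.restrict hs ht
    have me : MemH10 (x k) (x (k + 1)) e :=
      ⟨pe'.memH1, enode k hk.le, enode (k + 1) hk⟩
    have h1 := hu.form_element hx hk me
    have h2 := (sol I hI).2 k hk e me
    rw [form_eq_integral (pu.restrict hs ht) pe'] at h1
    rw [form_eq_integral (pI.restrict hs ht) pe'] at h2
    have hA' := ae_restrict_of_ae_restrict_of_subset (hx.Ioo_subset hk) hA
    have h3 := integral_sub
      (integrable_form (b := b) (hAm.mono_measure hμ) hA' (pu.restrict hs ht).memLp pe')
      (integrable_form (b := b) (hAm.mono_measure hμ) hA' (pI.restrict hs ht).memLp pe')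
    rw [h1, h2, sub_zero, load] at h3
    rw [← h3]
    congr 1
    ext y
    simp only [hg, Pi.sub_apply]
    ring)
  -- The discrete error.
  set w := uH - I with hw
  have hwV : w ∈ advSpace N ψ := Submodule.sub_mem _ huH.1 hI
  have solw := sol w hwV
  have pw := solw.1.1.isPrimitive
  set p := weakDeriv 0 L w with hp
  have pae : p =ᵐ[volume.restrict (Set.Ioo 0 L)] weakDeriv 0 L uH - weakDeriv 0 L I :=
    (pUH.sub pI).weakDeriv_ae_eq
  have cross := hx.form_interpolation_error hAm hA pe enode solw
  -- Galerkin orthogonality: `e - w = u - uH` and `a(u - uH, w) = 0`, whence `a(w, w) = a(e, w)`.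
  have orth : ∫ y in Set.Ioo 0 L, (A y * p y * p y + b * p y * w y)
      = ∫ y in Set.Ioo 0 L, (A y * g y * p y + b * g y * w y) := by
    have h1 := (hu.2 w solw.1).trans (huH.2 w hwV).symm
    rw [form_eq_integral pu pw, form_eq_integral pUH pw] at h1
    have i1 := integrable_form (b := b) hAm hA pu.memLp pw
    have i2 := integrable_form (b := b) hAm hA pUH.memLp pw
    have i3 := integrable_form (b := b) hAm hA pw.memLp pw
    have h2 := integral_sub (integrable_form (b := b) hAm hA pe.memLp pw) (i1.sub i2)
    simp only [Pi.sub_apply] at h2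
    rw [integral_sub i1 i2, h1, sub_self, sub_zero] at h2
    rw [← h2]
    refine integral_congr_ae ?_
    filter_upwards [pae] with y hy
    simp only [Pi.sub_apply] at hy
    simp only [hg, Pi.sub_apply]
    rw [hy]
    ring
  have coer := pw.coercive (b := b) hAm hA hL.le solw.1.2.1 solw.1.2.2
  rw [orth, cross] at coer
  have cs := sq_integral_mul_le pw.memLp pe.memLp_self
  -- The seminorm of the total error.
  have qae : weakDeriv 0 L (u - uH) =ᵐ[volume.restrict (Set.Ioo 0 L)] fun y => g y - p y := by
    filter_upwards [(pu.sub pUH).weakDeriv_ae_eq, pae] with y h1 h2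
    rw [h1, h2]
    simp [hg]
  have hsemi : seminormH1 0 L (u - uH) = √(∫ y in Set.Ioo 0 L, (g y - p y) ^ 2) := by
    rw [seminormH1, normL2]
    congr 1
    refine integral_congr_ae ?_
    filter_upwards [qae] with y hy
    rw [hy]
  rw [hsemi, normL2]
  refine (sqrt_integral_sub_sq_le pe.memLp pw.memLp).trans ?_
  obtain ⟨est1, est2⟩ := est
  have hX : 0 ≤ ∫ y in Set.Ioo 0 L, g y ^ 2 := integral_nonneg fun y => sq_nonneg _
  have hY : 0 ≤ ∫ y in Set.Ioo 0 L, e y ^ 2 := integral_nonneg fun y => sq_nonneg _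
  have hZ : 0 ≤ ∫ y in Set.Ioo 0 L, p y ^ 2 := integral_nonneg fun y => sq_nonneg _
  have hF : 0 ≤ ∫ y in Set.Ioo 0 L, f y ^ 2 := integral_nonneg fun y => sq_nonneg _
  set X := ∫ y in Set.Ioo 0 L, g y ^ 2
  set Y := ∫ y in Set.Ioo 0 L, e y ^ 2
  set Z := ∫ y in Set.Ioo 0 L, p y ^ 2
  set F := ∫ y in Set.Ioo 0 L, f y ^ 2
  set S := ∫ y in Set.Ioo 0 L, p y * e y
  -- The estimate holds without `√(α₂ / α₁)`, and even with an extra `1 / √2`; the square root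
  -- enters only as a factor at least `1`.
  have bX : √X ≤ H * √(α₂ / α₁) * (√F / α₁) := by
    have h1 : 1 ≤ √(α₂ / α₁) := Real.one_le_sqrt.2 ((one_le_div hα₁).2 hα)
    have h2 : √X ≤ H * (√F / α₁) := by
      refine Real.sqrt_le_iff.2 ⟨by positivity, ?_⟩
      rw [mul_pow, div_pow, Real.sq_sqrt hF, ← mul_div_assoc, le_div_iff₀ (by positivity)]
      nlinarith [mul_nonneg (sq_nonneg H) hF]
    calc √X ≤ H * (√F / α₁) * 1 := by rw [mul_one]; exact h2
      _ ≤ H * (√F / α₁) * √(α₂ / α₁) := by gcongr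
      _ = _ := by ring
  -- The factor `4 b²`, from the square of `2b`, is absorbed exactly by the two halves in `H² / 2 ·
  -- H² / 2`, leaving `b² H⁴`.
  have bZ : √Z ≤ H * (|b| * H / α₁) * (√F / α₁) := by
    refine Real.sqrt_le_iff.2 ⟨by positivity, ?_⟩
    have h1 : (α₁ * Z) ^ 2 ≤ 4 * b ^ 2 * (Z * Y) := by
      calc (α₁ * Z) ^ 2 ≤ (-(2 * b) * S) ^ 2 := pow_le_pow_left₀ (by positivity) coer 2
        _ = 4 * b ^ 2 * S ^ 2 := by ring
        _ ≤ _ := by gcongr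
    have h2 : α₁ ^ 2 * Z ≤ 4 * b ^ 2 * Y := by
      refine mul_le_of_sq_le_mul (by positivity) (by positivity) ?_
      calc (α₁ ^ 2 * Z) ^ 2 = α₁ ^ 2 * (α₁ * Z) ^ 2 := by ring
        _ ≤ α₁ ^ 2 * (4 * b ^ 2 * (Z * Y)) := by gcongr
        _ = _ := by ring
    have h3 : α₁ ^ 4 * Z ≤ b ^ 2 * H ^ 4 * F := by
      calc α₁ ^ 4 * Z = α₁ ^ 2 * (α₁ ^ 2 * Z) := by ring
        _ ≤ α₁ ^ 2 * (4 * b ^ 2 * (H ^ 2 / 2 * X)) :=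
          mul_le_mul_of_nonneg_left (h2.trans (by gcongr)) (by positivity)
        _ = 4 * b ^ 2 * (H ^ 2 / 2) * (α₁ ^ 2 * X) := by ring
        _ ≤ 4 * b ^ 2 * (H ^ 2 / 2) * (H ^ 2 / 2 * F) := by gcongr
        _ = _ := by ring
    have h4 : (H * (|b| * H / α₁) * (√F / α₁)) ^ 2 = b ^ 2 * H ^ 4 * F / α₁ ^ 4 := by
      simp only [mul_pow, div_pow, sq_abs, Real.sq_sqrt hF]
      field_simp
    rw [h4, le_div_iff₀ (by positivity)]
    linarith
  calc √X + √Z ≤ H * √(α₂ / α₁) * (√F / α₁) + H * (|b| * H / α₁) * (√F / α₁) := add_le_add bX bZ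
    _ = _ := by ring
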